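/- Let $\Omega=\mathbb{T}^d=\mathbb{R}^d/\mathbb{Z}^d$, let $\phi,\psi\in C^1(\Omega)$ with $\phi<\psi$ in $\Omega$, and for $\varepsilon>0$ put $|p|_\varepsilon=\sqrt{\varepsilon^2+|p|^2}$ for $p\in\mathbb{R}^d$ and $V_\varepsilon(s)=V_\varepsilon(x,s)=\frac1\varepsilon(\phi(x)-s)_+^4+\frac1\varepsilon(s-\psi(x))_+^4$, with $V_\varepsilon'=\partial_sV_\varepsilon$. Let $u_\varepsilon\in C^1(\Omega)$ for $\varepsilon\in(0,1)$ and let $u\in W^{1,\infty}(\Omega)$ have weak gradient $\nabla u$. Write $$\nu_\varepsilon=-\frac{\nabla u_\varepsilon}{|\nabla u_\varepsilon|_\varepsilon},\qquad H_\varepsilon=\operatorname{div}\nu_\varepsilon,\qquad f_\varepsilon=-V_\varepsilon'(u_\varepsilon),$$ where the divergence is taken in the sense of distributions and is assumed to be in $L^1(\Omega)$. Assume that (A1) $\sup_{\varepsilon\in(0,1),\,x\in\Omega}\{|u_\varepsilon(x)|,|\nabla u_\varepsilon(x)|\}<\infty$; (A2) $u_\varepsilon\to u$ uniformly in $\Omega$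 as $\varepsilon\to0$, and $\phi\le u\le\psi$ in $\Omega$; (A3) $\nabla u_\varepsilon\rightharpoonup\nabla u$ weakly-$*$ in $L^\infty(\Omega;\mathbb{R}^d)$ as $\varepsilon\to0$; (A4) $\sup_{\varepsilon\in(0,1)}\int_\Omega|-H_\varepsilon+f_\varepsilon|\,dx<\infty$. Then the following hold. (i) If $\varepsilon_i\in(0,1)$, $\varepsilon_i\to0$ and $\nu_{\varepsilon_i}\rightharpoonup\nu$ weakly-$*$ in $L^\infty(\Omega;\mathbb{R}^d)$, then $\nu(x)=-\frac{\nabla u(x)}{|\nabla u(x)|}$ for a.e. $x\in\{\nabla u\neq0\}$. (ii) $\nu_\varepsilon\to-\frac{\nabla u}{|\nabla u|}$ strongly in $L^2(\{\nabla u\ne0\};\mathbb{R}^d)$ as $\varepsilon\to0$. -/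

import Mathlib

open MeasureTheory Filter Topology Set

noncomputable section

namespace ObstacleMCF

/-- Euclidean space `ℝ^d`. Functions on the flat torus `𝕋^d = ℝ^d / ℤ^d` are represented by
`ℤ^d`-periodic functions on `ℝ^d`. -/
abbrev E (d : ℕ) : Type := EuclideanSpace ℝ (Fin d)

/-- `f` has period `1` in every coordinate direction, i.e. it is a function on `𝕋^d`. -/
def IsPeriodic {d : ℕ} {β : Type*} (f : E d → β) : Prop :=
  ∀ (i : Fin d) (x : E d), f (x + EuclideanSpace.single i (1 : ℝ)) = f x

/-- `f ∈ C¹(𝕋^d)`. -/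
def IsC1Torus {d : ℕ} (f : E d → ℝ) : Prop :=
  IsPeriodic f ∧ ContDiff ℝ 1 f

/-- The unit cube `[0,1)^d`, a fundamental domain of the torus. -/
def cube (d : ℕ) : Set (E d) := {x | ∀ i, x i ∈ Ico (0 : ℝ) 1}

/-- Lebesgue measure on the torus, as a measure on the fundamental domain.
Classes of functions modulo null sets (`L^p` functions on the torus) are represented by functions
whose values only matter on the cube. -/
def torusMeasure (d : ℕ) : Measure (E d) := volume.restrict (cube d)

/-- Weak-* convergence in `L^∞(𝕋^d; ℝ^d)`. -/
def WeakStarTendsto {d : ℕ} {ι : Type*} (l : Filter ι) (F : ι → E d → E d) (F₀ : E d → E d) :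
    Prop :=
  (∀ᶠ i in l, MemLp (F i) ⊤ (torusMeasure d)) ∧ MemLp F₀ ⊤ (torusMeasure d) ∧
  ∀ η : E d → E d, Integrable η (torusMeasure d) →
    Tendsto (fun i => ∫ x, inner ℝ (F i x) (η x) ∂(torusMeasure d)) l
      (𝓝 (∫ x, inner ℝ (F₀ x) (η x) ∂(torusMeasure d)))

/-- Strong convergence in `L²(A; ℝ^d)` for a subset `A` of the torus. -/
def StrongL2Tendsto {d : ℕ} {ι : Type*} (A : Set (E d)) (l : Filter ι) (F : ι → E d → E d)
    (F₀ : E d → E d) : Prop :=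
  (∀ᶠ i in l, MemLp (F i) 2 ((torusMeasure d).restrict A)) ∧
  MemLp F₀ 2 ((torusMeasure d).restrict A) ∧
  Tendsto (fun i => eLpNorm (F i - F₀) 2 ((torusMeasure d).restrict A)) l (𝓝 0)

/-- `u ∈ W^{1,∞}(𝕋^d)` with weak gradient `G`. -/
def IsW1InfWithGradient {d : ℕ} (u : E d → ℝ) (G : E d → E d) : Prop :=
  IsPeriodic u ∧ MemLp u ⊤ (torusMeasure d) ∧ MemLp G ⊤ (torusMeasure d) ∧
  ∀ ζ : E d → ℝ, IsC1Torus ζ → ∀ i : Fin d,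
    ∫ x, u x * (gradient ζ x) i ∂(torusMeasure d) = -∫ x, (G x) i * ζ x ∂(torusMeasure d)

/-- `h ∈ L¹(𝕋^d)` is the weak (distributional) divergence of the vector field `F`. -/
def IsWeakDivergence {d : ℕ} (F : E d → E d) (h : E d → ℝ) : Prop :=
  Integrable h (torusMeasure d) ∧
  ∀ ζ : E d → ℝ, IsC1Torus ζ →
    ∫ x, inner ℝ (F x) (gradient ζ x) ∂(torusMeasure d) = -∫ x, h x * ζ x ∂(torusMeasure d)

/-- `|p|_ε = √(ε² + |p|²)`. -/
def normEps {d : ℕ} (ε : ℝ) (p : E d) : ℝ := Real.sqrt (ε ^ 2 + ‖p‖ ^ 2)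

/-- The approximate normal `ν_ε = -∇v / |∇v|_ε`. -/
def approxNormal {d : ℕ} (ε : ℝ) (v : E d → ℝ) (x : E d) : E d :=
  -((normEps ε (gradient v x))⁻¹ • gradient v x)

/-- The penalization `V_ε(s) = (a - s)_+^4 / ε + (s - b)_+^4 / ε` for obstacle values `a`
(below) and `b` (above). -/
def potential (ε a b s : ℝ) : ℝ :=
  1 / ε * (max (a - s) 0) ^ 4 + 1 / ε * (max (s - b) 0) ^ 4

/-- The forcing `f_ε = -V_ε'(v)`, where `'` is the derivative in the variable `s`. -/
def forcing {d : ℕ} (ε : ℝ) (φ ψ v : E d → ℝ) (x : E d) : ℝ :=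
  -deriv (potential ε (φ x) (ψ x)) (v x)

end ObstacleMCF

end

namespace ObstacleMCF

/-! ### Measure-theoretic preliminaries -/

/-! Write `n = -Du / ‖Du‖`. Testing the divergence of `ν_ε` with `u_ε - u` gives `∫ ν_ε·(∇u_ε - Du)
= -∫ H_ε (u_ε - u)`. Neither `H_ε` nor `f_ε` is bounded in `L¹` separately, but `f_ε (u_ε - u) ≤ 0`
because `u` lies between the obstacles. Hence `∫ H_ε (u_ε - u) ≤ ∫ |-H_ε + f_ε| |u_ε - u|`, which is
infinitesimal.

Moreover `-∫ ν_ε·∇u_ε` equals `∫ |∇u_ε|` up to `O(ε)`, and weak lower semicontinuity bounds the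
latter below by `∫ |Du|` in the limit. So the nonnegative defect `∫ (|Du| + ν_ε·Du)` tends to zero
(`tendsto_integral_norm_add_inner`).

The defect controls `∫ |Du| |ν_ε - n|²` (`norm_mul_norm_sub_sq_le`). Since the fields are bounded,
the weight can be removed on `{Du ≠ 0}` (`tendsto_setIntegral_of_tendsto_integral_mul`). This is
(ii), and (i) follows because weak and strong limits agree. -/

lemma isBounded_cube (d : ℕ) : Bornology.IsBounded (cube d) := by
  refine (Metric.isBounded_closedBall (x := (0 : E d)) (r := √(d : ℝ))).subset fun x hx => ?_
  rw [mem_closedBall_zero_iff, EuclideanSpace.norm_eq]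
  refine Real.sqrt_le_sqrt ?_
  calc ∑ i, ‖x i‖ ^ 2 ≤ ∑ _i : Fin d, (1 : ℝ) := by
        refine Finset.sum_le_sum fun i _ => ?_
        obtain ⟨h0, h1⟩ := hx i
        rw [Real.norm_eq_abs, sq_abs]
        nlinarith
    _ = d := by simp

instance isFiniteMeasure_torusMeasure (d : ℕ) : IsFiniteMeasure (torusMeasure d) := by
  refine ⟨?_⟩
  rw [torusMeasure, Measure.restrict_apply_univ]
  exact (isBounded_cube d).measure_lt_top

lemma integrable_torusMeasure_of_continuous {d : ℕ} {F : Type*} [NormedAddCommGroup F]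
    {f : E d → F} (hf : Continuous f) : Integrable f (torusMeasure d) :=
  (hf.continuousOn.integrableOn_compact (isBounded_cube d).isCompact_closure).mono_set
    subset_closure

lemma integrable_inner_of_bounded {α F : Type*} [MeasurableSpace α] {μ : Measure α}
    [NormedAddCommGroup F] [InnerProductSpace ℝ F] {f g : α → F} {C : ℝ}
    (hf : AEStronglyMeasurable f μ) (hC : ∀ x, ‖f x‖ ≤ C) (hg : Integrable g μ) :
    Integrable (fun x => inner ℝ (f x) (g x)) μ := by
  refine (hg.norm.const_mul C).mono' (hf.inner hg.1) (ae_of_all _ fun x => ?_)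
  exact (norm_inner_le_norm _ _).trans (mul_le_mul_of_nonneg_right (hC x) (norm_nonneg _))

/-- If bounded nonnegative functions `g i` tend to zero in the weighted space `L¹(w)`, then they
tend to zero in `L¹` of the set where the weight is positive. -/
lemma tendsto_setIntegral_of_tendsto_integral_mul {α ι : Type*} [MeasurableSpace α]
    {μ : Measure α} [IsFiniteMeasure μ] {l : Filter ι} {w : α → ℝ} {g : ι → α → ℝ} {C : ℝ}
    (hw : Integrable w μ) (hw0 : ∀ x, 0 ≤ w x)
    (hg : ∀ᶠ i in l, AEStronglyMeasurable (g i) μ)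
    (hg0 : ∀ i x, 0 ≤ g i x) (hgC : ∀ᶠ i in l, ∀ x, g i x ≤ C)
    (h : Tendsto (fun i => ∫ x, w x * g i x ∂μ) l (𝓝 0)) :
    Tendsto (fun i => ∫ x in {x | w x ≠ 0}, g i x ∂μ) l (𝓝 0) := by
  -- The degenerate cases are split off so that `0 ≤ C` can be read off from a single value of `g`.
  rcases l.eq_or_neBot with rfl | hl
  · simp
  rcases isEmpty_or_nonempty α with hα | ⟨⟨a⟩⟩
  · simp [Measure.eq_zero_of_isEmpty μ]
  obtain ⟨i₀, hi₀⟩ := hgC.exists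
  have hC : 0 ≤ C := (hg0 i₀ a).trans (hi₀ a)
  have hA : NullMeasurableSet {x | w x ≠ 0} μ :=
    (hw.1.nullMeasurableSet_eq_fun aestronglyMeasurable_const).compl
  set A : Set α := {x | w x ≠ 0}
  have hwA : Integrable w (μ.restrict A) := hw.mono_measure Measure.restrict_le_self
  have hmeas : ∀ n : ℕ, AEStronglyMeasurable (fun x => C * max 0 (1 - n * w x)) (μ.restrict A) :=
    fun n => ((aestronglyMeasurable_const.sup
      (aestronglyMeasurable_const.sub (hwA.1.const_mul (n : ℝ)))).const_mul C)
  have hbd : ∀ (n : ℕ) x, ‖C * max 0 (1 - n * w x)‖ ≤ C := by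
    intro n x
    have h1 : max 0 (1 - n * w x) ≤ 1 :=
      max_le zero_le_one (by have := mul_nonneg n.cast_nonneg (hw0 x); linarith)
    rw [Real.norm_of_nonneg (mul_nonneg hC (le_max_left _ _))]
    exact mul_le_of_le_one_right hC h1
  -- From `1 ≤ n w + (1 - n w)₊` follows `∫_A g ≤ n ∫ w g + C ∫_A (1 - n w)₊`. The last term is
  -- small for large `n`, uniformly in `i`; with `n` then fixed, the first tends to zero along `l`.
  have hlim : Tendsto (fun n : ℕ => ∫ x in A, C * max 0 (1 - n * w x) ∂μ) atTop (𝓝 0) := by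
    have := tendsto_integral_of_dominated_convergence (μ := μ.restrict A)
      (F := fun (n : ℕ) x => C * max 0 (1 - n * w x)) (f := fun _ => 0) (fun _ => C)
      hmeas (integrable_const C) (fun n => ae_of_all _ (hbd n)) ?_
    · simpa using this
    filter_upwards [ae_restrict_mem₀ hA] with x hx
    have hx0 : 0 < w x := lt_of_le_of_ne (hw0 x) (Ne.symm hx)
    obtain ⟨N, hN⟩ := exists_nat_gt (1 / w x)
    refine tendsto_const_nhds.congr' ?_
    filter_upwards [eventually_ge_atTop N] with n hn
    have : (1 : ℝ) < n * w x := by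
      rw [← div_lt_iff₀ hx0]; exact hN.trans_le (by exact_mod_cast hn)
    rw [max_eq_left (by linarith), mul_zero]
  refine tendsto_order.2 ⟨fun b hb => Eventually.of_forall fun i =>
    hb.trans_le (integral_nonneg (hg0 i)), fun b hb => ?_⟩
  obtain ⟨n, hn⟩ := (hlim.eventually (gt_mem_nhds (half_pos hb))).exists
  have h' := (h.const_mul (n : ℝ)).eventually (gt_mem_nhds
    (show (n : ℝ) * 0 < b / 2 by simpa using half_pos hb))
  filter_upwards [hg, hgC, h'] with i hgi hgCi hi
  have hwg : Integrable (fun x => n * (w x * g i x)) μ := by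
    refine Integrable.const_mul ?_ _
    refine (hw.mul_const C).mono' (hw.1.mul hgi) (ae_of_all _ fun x => ?_)
    rw [Real.norm_of_nonneg (mul_nonneg (hw0 x) (hg0 i x))]
    exact mul_le_mul_of_nonneg_left (hgCi x) (hw0 x)
  have hwgA := hwg.mono_measure (Measure.restrict_le_self (s := A))
  have hCi : Integrable (fun x => C * max 0 (1 - n * w x)) (μ.restrict A) :=
    Integrable.of_bound (hmeas n) C (ae_of_all _ (hbd n))
  calc ∫ x in A, g i x ∂μ
      ≤ ∫ x in A, (n * (w x * g i x) + C * max 0 (1 - n * w x)) ∂μ := by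
        refine integral_mono_of_nonneg (ae_of_all _ (hg0 i)) (hwgA.add hCi)
          (ae_of_all _ fun x => ?_)
        have h1 : (1 - n * w x) * g i x ≤ max 0 (1 - n * w x) * C :=
          mul_le_mul (le_max_right _ _) (hgCi x) (hg0 i x) (le_max_left _ _)
        change g i x ≤ n * (w x * g i x) + C * max 0 (1 - n * w x)
        linarith
    _ = (∫ x in A, n * (w x * g i x) ∂μ) + ∫ x in A, C * max 0 (1 - n * w x) ∂μ :=
        integral_add hwgA hCi
    _ ≤ (∫ x, n * (w x * g i x) ∂μ) + ∫ x in A, C * max 0 (1 - n * w x) ∂μ := by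
        refine add_le_add ?_ le_rfl
        exact setIntegral_le_integral hwg (ae_of_all _ fun x =>
          mul_nonneg n.cast_nonneg (mul_nonneg (hw0 x) (hg0 i x)))
    _ < b := by
        rw [integral_const_mul]
        linarith

/-! ### Gradients and approximate normals -/

lemma IsC1Torus.continuous_gradient {d : ℕ} {v : E d → ℝ} (hv : IsC1Torus v) :
    Continuous (gradient v) :=
  (InnerProductSpace.toDual ℝ (E d)).symm.continuous.comp
    (hv.2.continuous_fderiv one_ne_zero)

lemma IsC1Torus.sub {d : ℕ} {v w : E d → ℝ} (hv : IsC1Torus v) (hw : IsC1Torus w) :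
    IsC1Torus (fun x => v x - w x) :=
  ⟨fun i x => by simp only [hv.1 i x, hw.1 i x], hv.2.sub hw.2⟩

lemma IsC1Torus.gradient_sub {d : ℕ} {v w : E d → ℝ} (hv : IsC1Torus v) (hw : IsC1Torus w)
    (x : E d) : gradient (fun y => v y - w y) x = gradient v x - gradient w x := by
  have h1 := (hv.2.differentiable one_ne_zero) x
  have h2 := (hw.2.differentiable one_ne_zero) x
  simp only [gradient, fderiv_fun_sub h1 h2, map_sub]

lemma normEps_pos {d : ℕ} {ε : ℝ} (hε : 0 < ε) (p : E d) : 0 < normEps ε p :=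
  Real.sqrt_pos.2 (by positivity)

lemma norm_le_normEps {d : ℕ} (ε : ℝ) (p : E d) : ‖p‖ ≤ normEps ε p :=
  Real.le_sqrt_of_sq_le (by nlinarith [sq_nonneg ε])

lemma normEps_le {d : ℕ} {ε : ℝ} (hε : 0 < ε) (p : E d) : normEps ε p ≤ ‖p‖ + ε := by
  refine Real.sqrt_le_iff.2 ⟨by positivity, ?_⟩
  nlinarith [mul_nonneg hε.le (norm_nonneg p)]

lemma norm_approxNormal_le_one {d : ℕ} {ε : ℝ} (hε : 0 < ε) (v : E d → ℝ) (x : E d) :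
    ‖approxNormal ε v x‖ ≤ 1 := by
  have h := normEps_pos hε (gradient v x)
  rw [approxNormal, norm_neg, norm_smul, norm_inv, Real.norm_of_nonneg h.le,
    inv_mul_le_iff₀ h, mul_one]
  exact norm_le_normEps _ _

lemma continuous_approxNormal {d : ℕ} {ε : ℝ} (hε : 0 < ε) {v : E d → ℝ} (hv : IsC1Torus v) :
    Continuous (approxNormal ε v) := by
  have hg := hv.continuous_gradient
  have hn : Continuous fun x => normEps ε (gradient v x) :=
    Real.continuous_sqrt.comp (continuous_const.add (hg.norm.pow 2))
  exact ((hn.inv₀ fun x => (normEps_pos hε _).ne').smul hg).neg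

/-- The approximate normal almost realizes the norm of the gradient. -/
lemma norm_gradient_le {d : ℕ} {ε : ℝ} (hε : 0 < ε) (v : E d → ℝ) (x : E d) :
    ‖gradient v x‖ ≤ -inner ℝ (approxNormal ε v x) (gradient v x) + ε := by
  set p := gradient v x
  have hs := normEps_pos hε p
  have h1 := normEps_le hε p
  have h2 := norm_le_normEps ε p
  have h3 := norm_nonneg p
  have h4 : -inner ℝ (approxNormal ε v x) p = ‖p‖ ^ 2 / normEps ε p := by
    rw [approxNormal, inner_neg_left, neg_neg, real_inner_smul_left, real_inner_self_eq_norm_sq,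
      div_eq_inv_mul]
  -- The claim becomes `(‖p‖ - ε) |p|_ε ≤ ‖p‖²`: the left side is nonpositive if `‖p‖ ≤ ε`, and
  -- otherwise at most `‖p‖² - ε²`.
  rw [h4, ← sub_le_iff_le_add, le_div_iff₀ hs]
  rcases le_total ‖p‖ ε with h | h
  · nlinarith
  · nlinarith [mul_le_mul_of_nonneg_left h1 (sub_nonneg.2 h), sq_nonneg ε]

/-! ### The penalization force -/

lemma hasDerivAt_max_zero_pow_four (t : ℝ) :
    HasDerivAt (fun s : ℝ => max s 0 ^ 4) (4 * max t 0 ^ 3) t := by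
  rcases lt_trichotomy t 0 with h | rfl | h
  · rw [max_eq_right h.le]
    refine ((hasDerivAt_const t (0 : ℝ)).congr_of_eventuallyEq ?_).congr_deriv (by norm_num)
    filter_upwards [gt_mem_nhds h] with s hs
    simp [max_eq_right hs.le]
  · rw [hasDerivAt_iff_isLittleO_nhds_zero]
    simp only [zero_add, max_self]
    refine Asymptotics.IsBigO.trans_isLittleO (g := fun h : ℝ => h ^ 4) ?_
      (by simpa using Asymptotics.isLittleO_pow_pow (𝕜 := ℝ) (m := 1) (n := 4) (by norm_num))
    refine Asymptotics.isBigO_of_le _ fun s => ?_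
    have : |max s 0| ≤ |s| := by
      rw [abs_of_nonneg (le_max_right s 0)]
      exact max_le (le_abs_self s) (abs_nonneg s)
    simpa [norm_pow] using pow_le_pow_left₀ (abs_nonneg _) this 4
  · rw [max_eq_left h.le]
    refine ((hasDerivAt_pow 4 t).congr_of_eventuallyEq ?_).congr_deriv (by norm_num)
    filter_upwards [lt_mem_nhds h] with s hs
    simp [max_eq_left hs.le]

lemma forcing_eq {d : ℕ} (ε : ℝ) (φ ψ v : E d → ℝ) (x : E d) :
    forcing ε φ ψ v x =
      4 / ε * max (φ x - v x) 0 ^ 3 - 4 / ε * max (v x - ψ x) 0 ^ 3 := by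
  have h1 := (hasDerivAt_max_zero_pow_four (φ x - v x)).comp (v x)
    ((hasDerivAt_id (v x)).const_sub (φ x))
  have h2 := (hasDerivAt_max_zero_pow_four (v x - ψ x)).comp (v x)
    ((hasDerivAt_id (v x)).sub_const (ψ x))
  have h : HasDerivAt (potential ε (φ x) (ψ x)) _ (v x) :=
    (h1.const_mul (1 / ε)).add (h2.const_mul (1 / ε))
  rw [forcing, h.deriv]
  ring

lemma continuous_forcing {d : ℕ} (ε : ℝ) {φ ψ v : E d → ℝ} (hφ : Continuous φ)
    (hψ : Continuous ψ) (hv : Continuous v) : Continuous (forcing ε φ ψ v) := by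
  simp only [funext (forcing_eq ε φ ψ v)]
  fun_prop

/-- The penalization force points towards the region between the obstacles. -/
lemma forcing_mul_sub_nonpos {d : ℕ} {ε : ℝ} (hε : 0 < ε) {φ ψ u v : E d → ℝ} {x : E d}
    (h1 : φ x ≤ u x) (h2 : u x ≤ ψ x) : forcing ε φ ψ v x * (v x - u x) ≤ 0 := by
  have hε' : 0 ≤ 4 / ε := by positivity
  -- The lower penalty acts only where `v < φ ≤ u`, the upper one only where `v > ψ ≥ u`.
  have a1 : max (φ x - v x) 0 ^ 3 * (v x - u x) ≤ 0 := by
    rcases le_total (φ x) (v x) with h | h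
    · simp [max_eq_right (sub_nonpos.2 h)]
    · exact mul_nonpos_of_nonneg_of_nonpos (by positivity) (by linarith)
  have a2 : 0 ≤ max (v x - ψ x) 0 ^ 3 * (v x - u x) := by
    rcases le_total (v x) (ψ x) with h | h
    · simp [max_eq_right (sub_nonpos.2 h)]
    · exact mul_nonneg (by positivity) (by linarith)
  rw [forcing_eq]
  nlinarith [mul_nonneg hε' a2, mul_nonneg hε' (neg_nonneg.2 a1)]

/-! ### The limit of the approximate normals -/

/-- The divergence identity tested with `v - u`, where `u` is a uniform limit of periodic `C¹`
functions `w δ` whose gradients converge weakly-* to `G`. -/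
lemma IsWeakDivergence.integral_inner_gradient_sub {d : ℕ} {F : E d → E d} {h : E d → ℝ}
    (hF : IsWeakDivergence F h) (hFc : Continuous F) {v u : E d → ℝ} (hv : IsC1Torus v)
    {C : ℝ} (hvC : ∀ x, |v x| ≤ C) {ι : Type*} {l : Filter ι} [l.NeBot] [l.IsCountablyGenerated]
    {w : ι → E d → ℝ} (hw : ∀ᶠ δ in l, IsC1Torus (w δ)) (hwC : ∀ᶠ δ in l, ∀ x, |w δ x| ≤ C)
    (hwu : TendstoUniformly w u l) {G : E d → E d}
    (hG : WeakStarTendsto l (fun δ => gradient (w δ)) G) :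
    (∫ x, inner ℝ (F x) (gradient v x) ∂(torusMeasure d)) -
        ∫ x, inner ℝ (F x) (G x) ∂(torusMeasure d) =
      -∫ x, h x * (v x - u x) ∂(torusMeasure d) := by
  -- Since `u` need not be `C¹`, the test function is `v - w δ`. The gradient term passes to the
  -- limit by weak-* convergence against the fixed field `F`, the other by dominated convergence.
  have hL := (hG.2.2 F (integrable_torusMeasure_of_continuous hFc)).const_sub
    (∫ x, inner ℝ (F x) (gradient v x) ∂(torusMeasure d))
  simp only [real_inner_comm (F _)] at hL
  have hR : Tendsto (fun δ => -∫ x, h x * (v x - w δ x) ∂(torusMeasure d)) l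
      (𝓝 (-∫ x, h x * (v x - u x) ∂(torusMeasure d))) := by
    refine (tendsto_integral_filter_of_dominated_convergence (fun x => |h x| * (C + C))
      ?_ ?_ (hF.1.abs.mul_const _) ?_).neg
    · filter_upwards [hw] with δ hδ
      exact hF.1.1.mul (hv.2.continuous.sub hδ.2.continuous).aestronglyMeasurable
    · filter_upwards [hwC] with δ hδ
      refine ae_of_all _ fun x => ?_
      rw [norm_mul, Real.norm_eq_abs, Real.norm_eq_abs]
      exact mul_le_mul_of_nonneg_left ((abs_sub _ _).trans (add_le_add (hvC x) (hδ x)))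
        (abs_nonneg _)
    · exact ae_of_all _ fun x => ((hwu.tendsto_at x).const_sub _).const_mul _
  refine tendsto_nhds_unique_of_eventuallyEq hL hR ?_
  filter_upwards [hw] with δ hδ
  have key := hF.2 _ (hv.sub hδ)
  simp only [hv.gradient_sub hδ, inner_sub_right] at key
  rw [integral_sub (integrable_torusMeasure_of_continuous (hFc.inner hv.continuous_gradient))
    (integrable_torusMeasure_of_continuous (hFc.inner hδ.continuous_gradient))] at key
  exact key

/-- The convention `0⁻¹ = 0` makes the direction field vanish where `p = 0`, so no case distinction
is needed in its uses. -/
lemma norm_inv_norm_smul_le_one {F : Type*} [NormedAddCommGroup F] [NormedSpace ℝ F] (p : F) :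
    ‖‖p‖⁻¹ • p‖ ≤ 1 := by
  rw [norm_smul, norm_inv, norm_norm]
  exact inv_mul_le_one

lemma aestronglyMeasurable_inv_norm_smul {α F : Type*} [MeasurableSpace α] {μ : Measure α}
    [NormedAddCommGroup F] [NormedSpace ℝ F] {f : α → F} (hf : AEStronglyMeasurable f μ) :
    AEStronglyMeasurable (fun x => ‖f x‖⁻¹ • f x) μ :=
  (hf.norm.aemeasurable.inv.aestronglyMeasurable).smul hf

lemma inner_inv_norm_smul_self {F : Type*} [NormedAddCommGroup F] [InnerProductSpace ℝ F]
    (p : F) : inner ℝ p (‖p‖⁻¹ • p) = ‖p‖ := by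
  rw [real_inner_smul_right, real_inner_self_eq_norm_sq]
  rcases eq_or_ne ‖p‖ 0 with h | h
  · simp [h]
  · field_simp

/-- For `‖ν‖ ≤ 1`, the defect in `-⟨ν, p⟩ ≤ ‖p‖` controls the distance of `ν` to `-p / ‖p‖`. -/
lemma norm_mul_norm_sub_sq_le {F : Type*} [NormedAddCommGroup F] [InnerProductSpace ℝ F]
    {ν : F} (hν : ‖ν‖ ≤ 1) (p : F) :
    ‖p‖ * ‖ν - -(‖p‖⁻¹ • p)‖ ^ 2 ≤ 2 * (‖p‖ + inner ℝ ν p) := by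
  rcases eq_or_ne p 0 with rfl | hp
  · simp
  have hp' : 0 < ‖p‖ := norm_pos_iff.2 hp
  have h1 : ‖‖p‖⁻¹ • p‖ = 1 := by
    rw [norm_smul, norm_inv, norm_norm, inv_mul_cancel₀ hp'.ne']
  -- Expanding the square leaves `‖p‖ ‖ν‖² + 2⟨ν, p⟩ + ‖p‖`, and `‖ν‖ ≤ 1` finishes.
  rw [sub_neg_eq_add, norm_add_sq_real, h1, real_inner_smul_right]
  have h2 : ‖p‖ * (‖ν‖ ^ 2 + 2 * (‖p‖⁻¹ * inner ℝ ν p) + 1 ^ 2) =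
      ‖p‖ * ‖ν‖ ^ 2 + 2 * inner ℝ ν p + ‖p‖ := by
    field_simp
  rw [h2]
  nlinarith [mul_le_mul_of_nonneg_left (pow_le_one₀ (n := 2) (norm_nonneg ν) hν) hp'.le]

/-- The alignment defect of the approximate normals with the limit gradient vanishes. -/
lemma tendsto_integral_norm_add_inner {d : ℕ} {φ ψ : E d → ℝ}
    (hφ : IsC1Torus φ) (hψ : IsC1Torus ψ) {uε : ℝ → E d → ℝ}
    (huε : ∀ ε ∈ Ioo (0 : ℝ) 1, IsC1Torus (uε ε)) {u : E d → ℝ} {Du : E d → E d}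
    {C : ℝ} (hC : ∀ ε ∈ Ioo (0 : ℝ) 1, ∀ x, |uε ε x| ≤ C)
    (hunif : TendstoUniformly uε u (𝓝[>] (0 : ℝ))) (hobs : ∀ x, φ x ≤ u x ∧ u x ≤ ψ x)
    (hweak : WeakStarTendsto (𝓝[>] (0 : ℝ)) (fun ε => gradient (uε ε)) Du)
    {H : ℝ → E d → ℝ}
    (hH : ∀ ε ∈ Ioo (0 : ℝ) 1, IsWeakDivergence (approxNormal ε (uε ε)) (H ε))
    {K : ℝ} (hK : ∀ ε ∈ Ioo (0 : ℝ) 1,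
      ∫ x, |-H ε x + forcing ε φ ψ (uε ε) x| ∂(torusMeasure d) ≤ K) :
    Tendsto (fun ε => ∫ x, (‖Du x‖ + inner ℝ (approxNormal ε (uε ε) x) (Du x)) ∂(torusMeasure d))
      (𝓝[>] (0 : ℝ)) (𝓝 0) := by
  set μ := torusMeasure d with hμ
  have hev : ∀ᶠ ε in 𝓝[>] (0 : ℝ), ε ∈ Ioo (0 : ℝ) 1 := Ioo_mem_nhdsGT one_pos
  have hDu : Integrable Du μ := hweak.2.1.integrable le_top
  have hK0 : 0 ≤ K :=
    (integral_nonneg fun x => abs_nonneg _).trans (hK (1 / 2) (by constructor <;> norm_num))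
  have hn : AEStronglyMeasurable (fun x => ‖Du x‖⁻¹ • Du x) μ :=
    aestronglyMeasurable_inv_norm_smul hDu.1
  -- Pairing with `Du / ‖Du‖` replaces lower semicontinuity: the pairing is at most `∫ |∇u_ε|` and
  -- converges to `∫ |Du|`.
  have hnorm : Tendsto (fun ε => ∫ x, inner ℝ (gradient (uε ε) x) (‖Du x‖⁻¹ • Du x) ∂μ)
      (𝓝[>] (0 : ℝ)) (𝓝 (∫ x, ‖Du x‖ ∂μ)) := by
    have := hweak.2.2 (fun x => ‖Du x‖⁻¹ • Du x) (Integrable.of_bound hn 1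
      (ae_of_all _ fun x => norm_inv_norm_smul_le_one _))
    simpa only [inner_inv_norm_smul_self] using this
  have huc : Continuous u :=
    hunif.continuous (hev.mono fun ε hε => (huε ε hε).2.continuous).frequently
  have hnn : ∀ᶠ ε in 𝓝[>] (0 : ℝ),
      0 ≤ ∫ x, (‖Du x‖ + inner ℝ (approxNormal ε (uε ε) x) (Du x)) ∂μ := by
    filter_upwards [hev] with ε hε
    refine integral_nonneg fun x => ?_
    have h1 := neg_le_of_abs_le (abs_real_inner_le_norm (approxNormal ε (uε ε) x) (Du x))
    have h2 := mul_le_mul_of_nonneg_right (norm_approxNormal_le_one hε.1 (uε ε) x)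
      (norm_nonneg (Du x))
    change 0 ≤ ‖Du x‖ + inner ℝ (approxNormal ε (uε ε) x) (Du x)
    linarith
  -- the defect is bounded by an explicit infinitesimal for every bound `η` of `|u_ε - u|`
  have hbound : ∀ η > 0, ∀ᶠ ε in 𝓝[>] (0 : ℝ),
      ∫ x, (‖Du x‖ + inner ℝ (approxNormal ε (uε ε) x) (Du x)) ∂μ ≤
        ((∫ x, ‖Du x‖ ∂μ) - ∫ x, inner ℝ (gradient (uε ε) x) (‖Du x‖⁻¹ • Du x) ∂μ) +
          ε * μ.real univ + K * η := by
    intro η hη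
    filter_upwards [hev, Metric.tendstoUniformly_iff.1 hunif η hη] with ε hε hdist
    have hv := huε ε hε
    have hνc := continuous_approxNormal hε.1 hv
    have hgi := integrable_torusMeasure_of_continuous hv.continuous_gradient
    have hνD : Integrable (fun x => inner ℝ (approxNormal ε (uε ε) x) (Du x)) μ :=
      integrable_inner_of_bounded hνc.aestronglyMeasurable
        (norm_approxNormal_le_one hε.1 _) hDu
    have hνg : Integrable (fun x => inner ℝ (approxNormal ε (uε ε) x) (gradient (uε ε) x)) μ :=
      integrable_torusMeasure_of_continuous (hνc.inner hv.continuous_gradient)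
    -- With this `ε` frozen, the family `uε` itself provides the `C¹` approximations of `u`; no
    -- mollification is needed.
    have hid := (hH ε hε).integral_inner_gradient_sub hνc hv (hC ε hε)
      (hev.mono huε) (hev.mono hC) hunif hweak
    have hfi : Integrable (forcing ε φ ψ (uε ε)) μ := integrable_torusMeasure_of_continuous
      (continuous_forcing ε hφ.2.continuous hψ.2.continuous hv.2.continuous)
    have hhi : Integrable (fun x => -H ε x + forcing ε φ ψ (uε ε) x) μ :=
      (hH ε hε).1.neg.add hfi
    have hdist' : ∀ x, |uε ε x - u x| ≤ η := fun x => by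
      have := (hdist x).le
      rwa [dist_comm, Real.dist_eq] at this
    -- Here `H = -(-H + f) + f`, and the contribution of the last `f` has a favourable sign.
    have hmass : ∫ x, H ε x * (uε ε x - u x) ∂μ ≤ K * η := by
      calc ∫ x, H ε x * (uε ε x - u x) ∂μ
          ≤ ∫ x, |-H ε x + forcing ε φ ψ (uε ε) x| * η ∂μ := by
            refine integral_mono ?_ (hhi.abs.mul_const η) fun x => ?_
            · exact (hH ε hε).1.mul_bdd (c := η)
                (hv.2.continuous.sub huc).aestronglyMeasurable (ae_of_all _ hdist')
            · have h1 := forcing_mul_sub_nonpos hε.1 (v := uε ε) (hobs x).1 (hobs x).2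
              have h2 : -((-H ε x + forcing ε φ ψ (uε ε) x) * (uε ε x - u x)) ≤
                  |-H ε x + forcing ε φ ψ (uε ε) x| * η := by
                refine (neg_le_abs _).trans ?_
                rw [abs_mul]
                exact mul_le_mul_of_nonneg_left (hdist' x) (abs_nonneg _)
              change H ε x * (uε ε x - u x) ≤ |-H ε x + forcing ε φ ψ (uε ε) x| * η
              linarith
        _ = (∫ x, |-H ε x + forcing ε φ ψ (uε ε) x| ∂μ) * η := integral_mul_const _ _
        _ ≤ K * η := mul_le_mul_of_nonneg_right (hK ε hε) hη.le
    have hgn : ∫ x, inner ℝ (gradient (uε ε) x) (‖Du x‖⁻¹ • Du x) ∂μ ≤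
        -(∫ x, inner ℝ (approxNormal ε (uε ε) x) (gradient (uε ε) x) ∂μ) + ε * μ.real univ := by
      calc ∫ x, inner ℝ (gradient (uε ε) x) (‖Du x‖⁻¹ • Du x) ∂μ
          ≤ ∫ x, (-inner ℝ (approxNormal ε (uε ε) x) (gradient (uε ε) x) + ε) ∂μ := by
            refine integral_mono ?_ (hνg.neg.add (integrable_const ε)) fun x => ?_
            · simpa only [real_inner_comm] using
                integrable_inner_of_bounded hn (fun x => norm_inv_norm_smul_le_one (Du x)) hgi
            · refine le_trans ?_ (norm_gradient_le hε.1 (uε ε) x)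
              refine (real_inner_le_norm _ _).trans ?_
              exact mul_le_of_le_one_right (norm_nonneg _) (norm_inv_norm_smul_le_one _)
        _ = _ := by
            have hνg' : Integrable
                (fun x => -inner ℝ (approxNormal ε (uε ε) x) (gradient (uε ε) x)) μ := hνg.neg
            rw [integral_add hνg' (integrable_const ε), integral_neg, integral_const, smul_eq_mul,
              mul_comm ε]
    rw [integral_add hDu.norm hνD]
    linarith
  have hmain : Tendsto (fun ε => ((∫ x, ‖Du x‖ ∂μ) -
      ∫ x, inner ℝ (gradient (uε ε) x) (‖Du x‖⁻¹ • Du x) ∂μ) + ε * μ.real univ)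
      (𝓝[>] (0 : ℝ)) (𝓝 0) := by
    have h0 : Tendsto (fun ε : ℝ => ε) (𝓝[>] (0 : ℝ)) (𝓝 0) := nhdsWithin_le_nhds
    simpa using (hnorm.const_sub (∫ x, ‖Du x‖ ∂μ)).add (h0.mul_const (μ.real univ))
  refine tendsto_order.2 ⟨fun b hb => hnn.mono fun ε hε => hb.trans_le hε, fun b hb => ?_⟩
  -- The `K + 1` keeps the denominator positive when `K = 0`.
  have hη : 0 < b / (2 * (K + 1)) := by positivity
  have hKη : K * (b / (2 * (K + 1))) ≤ b / 2 := by
    rw [mul_div_assoc', div_le_div_iff₀ (by positivity) two_pos]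
    nlinarith
  filter_upwards [hbound _ hη, hmain.eventually (gt_mem_nhds (half_pos hb))] with ε h1 h2
  linarith

/-- If `F i → F₀` in `L²(A)` and `F i ⇀ ν` weakly-* then `ν = F₀` almost everywhere on `A`. -/
lemma WeakStarTendsto.ae_eq_of_tendsto_setIntegral {d : ℕ} {ι : Type*} {l : Filter ι} [l.NeBot]
    {F : ι → E d → E d} {F₀ ν : E d → E d} (h : WeakStarTendsto l F ν)
    (hF₀ : MemLp F₀ ⊤ (torusMeasure d)) {A : Set (E d)}
    (hA : NullMeasurableSet A (torusMeasure d))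
    (hlim : Tendsto (fun i => ∫ x in A, ‖F i x - F₀ x‖ ^ 2 ∂(torusMeasure d)) l (𝓝 0)) :
    ∀ᵐ x ∂(torusMeasure d), x ∈ A → ν x = F₀ x := by
  set μ := torusMeasure d with hμ
  have hb : MemLp (fun x => ν x - F₀ x) ⊤ μ := h.2.1.sub hF₀
  have hbA : Integrable (A.indicator fun x => ν x - F₀ x) μ :=
    (hb.integrable le_top).indicator₀ hA
  have hset : ∀ G : E d → E d, ∫ x, inner ℝ (G x) (A.indicator (fun x => ν x - F₀ x) x) ∂μ =
      ∫ x in A, inner ℝ (G x) (ν x - F₀ x) ∂μ := by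
    intro G
    rw [← integral_indicator₀ hA]
    congr 1
    ext x
    by_cases hx : x ∈ A <;> simp [hx]
  have hmem : ∀ G : E d → E d, MemLp G ⊤ μ →
      Integrable (fun x => inner ℝ (G x) (ν x - F₀ x)) (μ.restrict A) ∧
      Integrable (fun x => ‖G x‖ ^ 2) (μ.restrict A) := by
    intro G hG
    have h2 : MemLp G 2 μ := hG.mono_exponent le_top
    have hb2 : MemLp (fun x => ν x - F₀ x) 2 μ := hb.mono_exponent le_top
    have hinner : Integrable (fun x => inner ℝ (G x) (ν x - F₀ x)) μ :=
      (h2.norm.integrable_mul hb2.norm).mono' (hG.1.inner hb.1)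
        (ae_of_all _ fun x => norm_inner_le_norm _ _)
    exact ⟨hinner.mono_measure Measure.restrict_le_self,
      (h2.integrable_norm_pow two_ne_zero).mono_measure Measure.restrict_le_self⟩
  have hI := (hmem _ hb).2
  have hlim1 := h.2.2 _ hbA
  simp only [← hμ, hset] at hlim1
  have hlim2 := hlim1.sub_const (∫ x in A, inner ℝ (F₀ x) (ν x - F₀ x) ∂μ)
  have hval : (∫ x in A, inner ℝ (ν x) (ν x - F₀ x) ∂μ) -
      ∫ x in A, inner ℝ (F₀ x) (ν x - F₀ x) ∂μ = ∫ x in A, ‖ν x - F₀ x‖ ^ 2 ∂μ := by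
    rw [← integral_sub (hmem _ h.2.1).1 (hmem _ hF₀).1]
    congr 1
    ext x
    rw [← inner_sub_left, real_inner_self_eq_norm_sq]
  rw [hval] at hlim2
  -- Young's inequality for `⟨F i - F₀, ν - F₀⟩` gives `X ≤ X / 2` in the limit for `X = ∫_A ‖ν -
  -- F₀‖²`, which forces `X = 0`.
  have hle : ∫ x in A, ‖ν x - F₀ x‖ ^ 2 ∂μ ≤
      1 / 2 * 0 + 1 / 2 * ∫ x in A, ‖ν x - F₀ x‖ ^ 2 ∂μ := by
    refine le_of_tendsto_of_tendsto hlim2 ((hlim.const_mul (1 / 2)).add_const _) ?_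
    filter_upwards [h.1] with i hi
    have hd := (hmem (fun x => F i x - F₀ x) (hi.sub hF₀))
    rw [← integral_sub (hmem _ hi).1 (hmem _ hF₀).1, ← integral_const_mul, ← integral_const_mul,
      ← integral_add (hd.2.const_mul _) (hI.const_mul _)]
    refine integral_mono ((hmem _ hi).1.sub (hmem _ hF₀).1)
      ((hd.2.const_mul _).add (hI.const_mul _)) fun x => ?_
    change inner ℝ (F i x) (ν x - F₀ x) - inner ℝ (F₀ x) (ν x - F₀ x) ≤
      1 / 2 * ‖F i x - F₀ x‖ ^ 2 + 1 / 2 * ‖ν x - F₀ x‖ ^ 2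
    rw [← inner_sub_left]
    have h1 := real_inner_le_norm (F i x - F₀ x) (ν x - F₀ x)
    nlinarith [sq_nonneg (‖F i x - F₀ x‖ - ‖ν x - F₀ x‖)]
  have hzero : ∫ x in A, ‖ν x - F₀ x‖ ^ 2 ∂μ = 0 :=
    le_antisymm (by linarith) (integral_nonneg fun x => by positivity)
  rw [integral_eq_zero_iff_of_nonneg_ae (ae_of_all _ fun x => by positivity) hI] at hzero
  filter_upwards [(ae_restrict_iff'₀ hA).1 hzero] with x hx hxA
  have := hx hxA
  simpa [sub_eq_zero] using this

end ObstacleMCF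

theorem mainTheorem11 {d : ℕ}
    -- the obstacles
    (φ ψ : ObstacleMCF.E d → ℝ)
    (hφ : ObstacleMCF.IsC1Torus φ) (hψ : ObstacleMCF.IsC1Torus ψ)
    (hφψ : ∀ x, φ x < ψ x)
    -- the family `u_ε ∈ C¹`, `0 < ε < 1`, and `u ∈ W^{1,∞}` with weak gradient `Du`
    (uε : ℝ → ObstacleMCF.E d → ℝ)
    (huε : ∀ ε ∈ Set.Ioo (0 : ℝ) 1, ObstacleMCF.IsC1Torus (uε ε))
    (u : ObstacleMCF.E d → ℝ) (Du : ObstacleMCF.E d → ObstacleMCF.E d)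
    (hu : ObstacleMCF.IsW1InfWithGradient u Du)
    -- (A1)
    (hA1 : ∃ C : ℝ, ∀ ε ∈ Set.Ioo (0 : ℝ) 1, ∀ x,
      |uε ε x| ≤ C ∧ ‖gradient (uε ε) x‖ ≤ C)
    -- (A2)
    (hA2 : TendstoUniformly uε u (𝓝[>] (0 : ℝ)))
    (hA2' : ∀ x, φ x ≤ u x ∧ u x ≤ ψ x)
    -- (A3)
    (hA3 : ObstacleMCF.WeakStarTendsto (𝓝[>] (0 : ℝ)) (fun ε => gradient (uε ε)) Du)
    -- (A4), with `H_ε = div ν_ε`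
    (H : ℝ → ObstacleMCF.E d → ℝ)
    (hH : ∀ ε ∈ Set.Ioo (0 : ℝ) 1,
      ObstacleMCF.IsWeakDivergence (ObstacleMCF.approxNormal ε (uε ε)) (H ε))
    (hA4 : ∃ C : ℝ, ∀ ε ∈ Set.Ioo (0 : ℝ) 1,
      ∫ x, |-H ε x + ObstacleMCF.forcing ε φ ψ (uε ε) x| ∂(ObstacleMCF.torusMeasure d) ≤ C) :
    -- (i) every weak-* limit along a sequence `ε_i → 0`
    (∀ (e : ℕ → ℝ), (∀ i, e i ∈ Set.Ioo (0 : ℝ) 1) → Tendsto e atTop (𝓝 0) →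
      ∀ ν : ObstacleMCF.E d → ObstacleMCF.E d,
        ObstacleMCF.WeakStarTendsto atTop
          (fun i => ObstacleMCF.approxNormal (e i) (uε (e i))) ν →
        ∀ᵐ x ∂(ObstacleMCF.torusMeasure d), Du x ≠ 0 → ν x = -(‖Du x‖⁻¹ • Du x)) ∧
    -- (ii) strong convergence of the whole family
    ObstacleMCF.StrongL2Tendsto {x | Du x ≠ 0} (𝓝[>] (0 : ℝ))
      (fun ε => ObstacleMCF.approxNormal ε (uε ε)) (fun x => -(‖Du x‖⁻¹ • Du x)) := by
  open ObstacleMCF in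
  obtain ⟨C, hC⟩ := hA1
  obtain ⟨K, hK⟩ := hA4
  have hev : ∀ᶠ ε in 𝓝[>] (0 : ℝ), ε ∈ Ioo (0 : ℝ) 1 := Ioo_mem_nhdsGT one_pos
  have hDu : Integrable Du (torusMeasure d) := hA3.2.1.integrable le_top
  have hn : AEStronglyMeasurable (fun x => -(‖Du x‖⁻¹ • Du x)) (torusMeasure d) :=
    (aestronglyMeasurable_inv_norm_smul hDu.1).neg
  have hn1 : ∀ x, ‖-(‖Du x‖⁻¹ • Du x)‖ ≤ 1 := fun x => by
    rw [norm_neg]; exact norm_inv_norm_smul_le_one _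
  have hA : NullMeasurableSet {x | Du x ≠ 0} (torusMeasure d) :=
    (hDu.1.nullMeasurableSet_eq_fun aestronglyMeasurable_const).compl
  have hdefect := tendsto_integral_norm_add_inner hφ hψ huε (fun ε hε x => (hC ε hε x).1)
    hA2 hA2' hA3 hH hK
  have hmeas : ∀ ε ∈ Ioo (0 : ℝ) 1, AEStronglyMeasurable
      (fun x => approxNormal ε (uε ε) x - -(‖Du x‖⁻¹ • Du x)) (torusMeasure d) :=
    fun ε hε => (continuous_approxNormal hε.1 (huε ε hε)).aestronglyMeasurable.sub hn
  have hle2 : ∀ ε ∈ Ioo (0 : ℝ) 1, ∀ x,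
      ‖approxNormal ε (uε ε) x - -(‖Du x‖⁻¹ • Du x)‖ ≤ 2 := fun ε hε x =>
    (norm_sub_le _ _).trans (by linarith [norm_approxNormal_le_one hε.1 (uε ε) x, hn1 x])
  have hweighted : Tendsto (fun ε => ∫ x, ‖Du x‖ *
      ‖approxNormal ε (uε ε) x - -(‖Du x‖⁻¹ • Du x)‖ ^ 2 ∂(torusMeasure d))
      (𝓝[>] (0 : ℝ)) (𝓝 0) := by
    refine squeeze_zero' (Eventually.of_forall fun ε => integral_nonneg fun x => by positivity) ?_
      (by simpa using hdefect.const_mul 2)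
    filter_upwards [hev] with ε hε
    rw [← integral_const_mul]
    refine integral_mono_of_nonneg (ae_of_all _ fun x => by positivity) ?_
      (ae_of_all _ fun x =>
        norm_mul_norm_sub_sq_le (norm_approxNormal_le_one hε.1 (uε ε) x) (Du x))
    exact (hDu.norm.add (integrable_inner_of_bounded
      (continuous_approxNormal hε.1 (huε ε hε)).aestronglyMeasurable
      (norm_approxNormal_le_one hε.1 _) hDu)).const_mul 2
  -- The bound `2 ^ 2` comes from two fields of norm at most one.
  have hL2 := tendsto_setIntegral_of_tendsto_integral_mul (C := 2 ^ 2)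
    (g := fun ε x => ‖approxNormal ε (uε ε) x - -(‖Du x‖⁻¹ • Du x)‖ ^ 2) hDu.norm
    (fun x => norm_nonneg _) (hev.mono fun ε hε => (hmeas ε hε).norm.pow 2)
    (fun ε x => by positivity)
    (hev.mono fun ε hε x => pow_le_pow_left₀ (norm_nonneg _) (hle2 ε hε x) 2) hweighted
  simp only [norm_ne_zero_iff] at hL2
  refine ⟨fun e he he0 ν hν => ?_, ?_, ?_, ?_⟩
  · have he' : Tendsto e atTop (𝓝[>] (0 : ℝ)) :=
      tendsto_nhdsWithin_iff.2 ⟨he0, Eventually.of_forall fun i => (he i).1⟩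
    exact hν.ae_eq_of_tendsto_setIntegral (MemLp.of_bound hn 1 (ae_of_all _ hn1)) hA
      (hL2.comp he')
  · filter_upwards [hev] with ε hε
    exact MemLp.of_bound (continuous_approxNormal hε.1 (huε ε hε)).aestronglyMeasurable 1
      (ae_of_all _ (norm_approxNormal_le_one hε.1 _))
  · exact MemLp.of_bound hn.restrict 1 (ae_of_all _ hn1)
  · have h0 : Tendsto (fun ε => ENNReal.ofReal ((∫ x in {x | Du x ≠ 0},
        ‖approxNormal ε (uε ε) x - -(‖Du x‖⁻¹ • Du x)‖ ^ 2 ∂(torusMeasure d)) ^ (2⁻¹ : ℝ)))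
        (𝓝[>] (0 : ℝ)) (𝓝 0) := by
      have := (ENNReal.continuous_ofReal.tendsto _).comp
        (hL2.rpow_const (p := (2⁻¹ : ℝ)) (Or.inr (by norm_num)))
      simpa [Function.comp_def] using this
    refine h0.congr' ?_
    filter_upwards [hev] with ε hε
    have hm : MemLp (approxNormal ε (uε ε) - fun x => -(‖Du x‖⁻¹ • Du x)) 2
        ((torusMeasure d).restrict {x | Du x ≠ 0}) :=
      MemLp.of_bound (hmeas ε hε).restrict 2 (ae_of_all _ (hle2 ε hε))
    rw [hm.eLpNorm_eq_integral_rpow_norm two_ne_zero ENNReal.ofNat_ne_top]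
    simp
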